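/- Let $\nu\ge 1$, $\lambda_1,\dots,\lambda_\nu>0$ and $\rho>0$. Let $\phi$ be the standard univariate normal density, and let $X=(X_1,\dots,X_\nu)^T$ be a random vector with the distribution of $N_\nu(0,\Lambda)$, $\Lambda=\mathrm{diag}(\lambda_1,\dots,\lambda_\nu)$, truncated to the open ball $B(\rho)=\{x\in\mathbb R^\nu : x^Tx<\rho\}$; that is, $X$ has the probability density $$f(x)=k\prod_{m=1}^{\nu}\lambda_m^{-1/2}\phi(\lambda_m^{-1/2}x_m)\ \text{ if } x\in B(\rho),\qquad f(x)=0\ \text{ otherwise},$$ where $k$ is the normalizing constant. Then, for every $1\le n\le\nu$, the variable $X_n^2$ is square-integrable and $$\mathrm{var}(X_n^2)\le 2\lambda_n\,E(X_n^2).$$ Moreover, for every $n$ and any fixed values of $\rho>0$ and of $\lambda_m>0$ $(m\ne n)$, the expectation $E(X_n^2/\lambda_n)$, taken under the truncated distribution with parameters $\lambda_1,\dots,\lambda_\nu$ and regarded as a function of $\lambda_n\in(0,\infty)$, is differentiable with $$\frac{\partial}{\partial\lambda_n}E(X_n^2/\lambda_n)\le 0,$$ and hence it is nonincreasing in $\lambda_n$.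 -/

import Mathlib

open MeasureTheory ProbabilityTheory

noncomputable section

namespace TruncNormal

/-- The open Euclidean ball `{x : xᵀ x < ρ}` in `ℝ^ν` (of squared radius `ρ`). -/
def ball (ν : ℕ) (ρ : ℝ) : Set (Fin ν → ℝ) :=
  {x | x ⬝ᵥ x < ρ}

/-- The density `∏ₙ λₙ^(-1/2) φ(λₙ^(-1/2) xₙ)` of `N_ν(0, diag(λ₁, …, λ_ν))`, where `φ` is the
standard univariate normal density. -/
def normalDensity {ν : ℕ} (lam : Fin ν → ℝ) (x : Fin ν → ℝ) : ℝ :=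
  ∏ n, (√(lam n))⁻¹ * gaussianPDFReal 0 1 ((√(lam n))⁻¹ * x n)

/-- The normalizing constant of the normal density restricted to the ball. -/
def normConst {ν : ℕ} (lam : Fin ν → ℝ) (ρ : ℝ) : ℝ :=
  (∫ x in ball ν ρ, normalDensity lam x)⁻¹

open Classical in
/-- The density of `N_ν(0, diag(λ₁, …, λ_ν))` truncated to the ball `{x : xᵀ x < ρ}`. -/
def density {ν : ℕ} (lam : Fin ν → ℝ) (ρ : ℝ) (x : Fin ν → ℝ) : ℝ :=
  if x ∈ ball ν ρ then normConst lam ρ * normalDensity lam x else 0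

/-- The truncated normal distribution: the measure on `ℝ^ν` with the above density with respect
to Lebesgue measure. -/
def law {ν : ℕ} (lam : Fin ν → ℝ) (ρ : ℝ) : Measure (Fin ν → ℝ) :=
  volume.withDensity fun x => ENNReal.ofReal (density lam ρ x)

end TruncNormal

end

/-! Write `τ = 1 / λₙ` and let `A j τ` be the unnormalized moment of `(xₙ²)^j` on the ball, so that
`A j' = -A (j+1) / 2`. The variance bound reads `τ (A 2 * A 0 - A 1²) ≤ 2 * A 1 * A 0`, which says
exactly that the second derivative of `t ↦ log A 0 (exp t)` is nonpositive. Up to the factor `-1/2`,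
the first derivative of that function is `τ * A 1 / A 0 = E(Xₙ² / λₙ)`, so the monotonicity claim is
the same fact.

Concavity in `log τ` means `A 0 a * A 0 b ≤ A 0 (√(a b))²` (`moment_zero_mul_le`). This is a
Prékopa–Leindler inequality with geometric means in `|xₙ|` and arithmetic means in the other
coordinates: `xy ≤ (x² + y²) / 2` keeps the mean point in the ball, and `√(ab) xy ≤ (a x² + b y²) /
2` controls the exponent (`splitWeight_mul_le`). -/

namespace TruncNormal

/-! ### Brunn–Minkowski and Prékopa–Leindler on the line -/

open scoped Pointwise in
/-- The one-dimensional Brunn–Minkowski inequality, for sets of midpoints. -/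
theorem volume_add_volume_le_two_mul_of_midpoint_mem {A B C : Set ℝ} (hA : MeasurableSet A)
    (hB : MeasurableSet B) (hAne : A.Nonempty) (hBne : B.Nonempty)
    (hC : ∀ a ∈ A, ∀ b ∈ B, (a + b) / 2 ∈ C) :
    volume A + volume B ≤ 2 * volume C := by
  have scale : ∀ (K : Set ℝ) (c : ℝ), 2 * volume ((fun x => (1 / 2 : ℝ) * x + c) '' K) = volume K := by
    intro K c
    have : (fun x => (1 / 2 : ℝ) * x + c) '' K = (fun x => x + c) '' ((1 / 2 : ℝ) • K) := by
      rw [← Set.image_smul, Set.image_image]; simp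
    rw [this, Set.image_add_right, measure_preimage_add_right, Measure.addHaar_smul]
    simp only [Module.finrank_self, pow_one, one_div]
    rw [← mul_assoc, abs_of_pos (by norm_num), ENNReal.ofReal_inv_of_pos (by norm_num)]
    rw [ENNReal.ofReal_ofNat, ENNReal.mul_inv_cancel (by norm_num) (by norm_num), one_mul]
  have key : ∀ K L : Set ℝ, K ⊆ A → L ⊆ B → IsCompact K → IsCompact L → K.Nonempty → L.Nonempty →
      volume K + volume L ≤ 2 * volume C := by
    intro K L hKA hLB hK hL hKne hLne
    set a := sSup K
    set b := sInf L
    have ha : a ∈ K := hK.sSup_mem hKne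
    have hb : b ∈ L := hL.sInf_mem hLne
    -- Averaging `K` with the least point of `L`, and `L` with the greatest point of `K`, gives two
    -- half-size copies inside `C` that can meet only at `(a + b) / 2`.
    set S := (fun x => (1 / 2 : ℝ) * x + b / 2) '' K
    set T := (fun x => (1 / 2 : ℝ) * x + a / 2) '' L
    have hT : IsCompact T := hL.image (by fun_prop)
    have hST : AEDisjoint volume S T := by
      refine measure_mono_null (t := {(a + b) / 2}) ?_ (by simp)
      rintro _ ⟨⟨x, hx, rfl⟩, ⟨y, hy, hxy⟩⟩
      have h1 : x ≤ a := le_csSup hK.bddAbove hx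
      have h2 : b ≤ y := csInf_le hL.bddBelow hy
      simp only at hxy
      simp only [Set.mem_singleton_iff]
      linarith
    have hsub : S ∪ T ⊆ C := by
      rintro _ (⟨x, hx, rfl⟩ | ⟨y, hy, rfl⟩)
      · convert hC x (hKA hx) b (hLB hb) using 1
        ring
      · convert hC a (hKA ha) y (hLB hy) using 1
        ring
    calc volume K + volume L = 2 * (volume S + volume T) := by rw [mul_add, scale, scale]
      _ = 2 * volume (S ∪ T) := by rw [measure_union₀ hT.measurableSet.nullMeasurableSet hST]
      _ ≤ 2 * volume C := by gcongr
  obtain ⟨a, ha⟩ := hAne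
  obtain ⟨b, hb⟩ := hBne
  have approx : ∀ {D : Set ℝ}, MeasurableSet D → ∀ r < volume D,
      ∃ K ⊆ D, IsCompact K ∧ K.Nonempty ∧ r ≤ volume K := by
    intro D hD r hr
    obtain ⟨K, hKD, hK, hrK⟩ := hD.exists_lt_isCompact hr
    refine ⟨K, hKD, hK, ?_, hrK.le⟩
    rw [Set.nonempty_iff_ne_empty]
    rintro rfl
    simp at hrK
  -- Inner regularity passes from compact sets to `D`; singletons supply a nonempty compact set when
  -- `D` is null.
  have approx' : ∀ {D : Set ℝ} (d : ℝ), MeasurableSet D → d ∈ D →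
      ∀ z w : ENNReal, (∀ K ⊆ D, IsCompact K → K.Nonempty → volume K + z ≤ w) →
        volume D + z ≤ w := by
    intro D d hD hd z w h
    rcases eq_or_ne (volume D) 0 with h0 | h0
    · have := h {d} (by simpa using hd) isCompact_singleton (by simp)
      simpa [h0] using this
    · rcases eq_or_ne z ⊤ with rfl | hz
      · have := h {d} (by simpa using hd) isCompact_singleton (by simp)
        simpa using this
      have hzw : z ≤ w := by
        have := h {d} (by simpa using hd) isCompact_singleton (by simp)
        simpa using this
      have : volume D ≤ w - z := by
        refine le_of_forall_lt fun r hr => ?_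
        obtain ⟨r', hr, hr'⟩ := exists_between hr
        obtain ⟨K, hKD, hK, hKne, hrK⟩ := approx hD r' hr'
        refine hr.trans_le (hrK.trans ?_)
        exact ENNReal.le_sub_of_add_le_right hz (h K hKD hK hKne)
      calc volume D + z ≤ (w - z) + z := by gcongr
        _ = w := tsub_add_cancel_of_le hzw
  refine approx' a hA ha _ _ fun K hKA hK hKne => ?_
  rw [add_comm]
  refine approx' b hB hb _ _ fun L hLB hL hLne => ?_
  rw [add_comm]
  exact key K L hKA hLB hK hL hKne hLne

/-- Layer-cake: midpoints of `{f > t}` and `{g > t}` lie in `{h > t}`, and Brunn–Minkowski applies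
at each level. The common supremum `M` makes both level sets nonempty for `t < M` and both empty
beyond. -/
theorem lintegral_add_lintegral_le_of_midpoint {f g h : ℝ → ℝ} (hf : Measurable f)
    (hg : Measurable g) (hh : Measurable h) (hf0 : ∀ x, 0 ≤ f x) (hg0 : ∀ x, 0 ≤ g x)
    (hh0 : ∀ x, 0 ≤ h x) {M : ℝ} (hfM : ∀ x, f x ≤ M) (hgM : ∀ x, g x ≤ M)
    (hfM' : ∀ t < M, ∃ x, t < f x) (hgM' : ∀ t < M, ∃ x, t < g x)
    (H : ∀ x y, f x * g y ≤ h ((x + y) / 2) ^ 2) :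
    (∫⁻ x, ENNReal.ofReal (f x)) + ∫⁻ x, ENNReal.ofReal (g x) ≤
      2 * ∫⁻ x, ENNReal.ofReal (h x) := by
  rw [lintegral_eq_lintegral_meas_lt _ (.of_forall hf0) hf.aemeasurable,
    lintegral_eq_lintegral_meas_lt _ (.of_forall hg0) hg.aemeasurable,
    lintegral_eq_lintegral_meas_lt _ (.of_forall hh0) hh.aemeasurable,
    ← lintegral_const_mul' _ _ (by norm_num), ← lintegral_add_left]
  · refine setLIntegral_mono' measurableSet_Ioi fun t ht => ?_
    rcases lt_or_ge t M with htM | htM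
    · refine volume_add_volume_le_two_mul_of_midpoint_mem (measurableSet_lt measurable_const hf)
        (measurableSet_lt measurable_const hg) (hfM' t htM) (hgM' t htM) ?_
      intro a ha b hb
      simp only [Set.mem_ofPred_eq, Set.mem_Ioi] at ha hb ht ⊢
      refine lt_of_pow_lt_pow_left₀ 2 (hh0 _) (lt_of_lt_of_le ?_ (H a b))
      rw [sq]
      exact mul_lt_mul'' ha hb ht.le ht.le
    · have h1 : {a | t < f a} = ∅ := by
        ext a; simpa using (hfM a).trans htM
      have h2 : {a | t < g a} = ∅ := by
        ext a; simpa using (hgM a).trans htM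
      simp [h1, h2]
  · exact Antitone.measurable fun s t hst => measure_mono fun x hx => lt_of_le_of_lt hst hx

theorem four_mul_mul_le_add_sq (a b : ENNReal) : 4 * (a * b) ≤ (a + b) ^ 2 := by
  rcases eq_or_ne a ⊤ with rfl | ha
  · simp
  rcases eq_or_ne b ⊤ with rfl | hb
  · simp
  lift a to NNReal using ha
  lift b to NNReal using hb
  norm_cast
  rw [← NNReal.coe_le_coe]
  push_cast
  nlinarith [sq_nonneg ((a : ℝ) - b)]

/-- Replacing `f, g` by `α f, α⁻¹ g` preserves the products `f x * g y`, so the suprema can be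
equalized; AM-GM then turns the additive inequality into the multiplicative one. -/
theorem lintegral_mul_lintegral_le_of_midpoint_of_le {f g h : ℝ → ℝ} (hf : Measurable f)
    (hg : Measurable g) (hh : Measurable h) (hf0 : ∀ x, 0 ≤ f x) (hg0 : ∀ x, 0 ≤ g x)
    (hh0 : ∀ x, 0 ≤ h x) {M : ℝ} (hfM : ∀ x, f x ≤ M) (hgM : ∀ x, g x ≤ M)
    (H : ∀ x y, f x * g y ≤ h ((x + y) / 2) ^ 2) :
    (∫⁻ x, ENNReal.ofReal (f x)) * ∫⁻ x, ENNReal.ofReal (g x) ≤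
      (∫⁻ x, ENNReal.ofReal (h x)) ^ 2 := by
  have hfb : BddAbove (Set.range f) := ⟨M, by rintro _ ⟨x, rfl⟩; exact hfM x⟩
  have hgb : BddAbove (Set.range g) := ⟨M, by rintro _ ⟨x, rfl⟩; exact hgM x⟩
  set F := ⨆ x, f x
  set G := ⨆ x, g x
  have hfF : ∀ x, f x ≤ F := le_ciSup hfb
  have hgG : ∀ x, g x ≤ G := le_ciSup hgb
  rcases ((hf0 0).trans (hfF 0)).eq_or_lt with hF | hF
  · have : ∀ x, f x = 0 := fun x => le_antisymm ((hfF x).trans hF.ge) (hf0 x)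
    simp [this]
  rcases ((hg0 0).trans (hgG 0)).eq_or_lt with hG | hG
  · have : ∀ x, g x = 0 := fun x => le_antisymm ((hgG x).trans hG.ge) (hg0 x)
    simp [this]
  set α := √(G / F)
  have hα : 0 < α := Real.sqrt_pos.2 (div_pos hG hF)
  have hαα : α * α = G / F := Real.mul_self_sqrt (div_pos hG hF).le
  have hαG : α⁻¹ * G = α * F := by
    rw [inv_mul_eq_iff_eq_mul₀ hα.ne', ← mul_assoc, hαα, div_mul_cancel₀ _ hF.ne']
  have key := lintegral_add_lintegral_le_of_midpoint (f := fun x => α * f x)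
    (g := fun x => α⁻¹ * g x) (h := h) (M := α * F) (hf.const_mul _) (hg.const_mul _) hh
    (fun x => mul_nonneg hα.le (hf0 x)) (fun x => mul_nonneg (inv_pos.2 hα).le (hg0 x)) hh0
    (fun x => by have := hfF x; gcongr) (fun x => by rw [← hαG]; have := hgG x; gcongr)
    (fun t ht => by
      obtain ⟨x, hx⟩ := exists_lt_of_lt_ciSup (f := f) (b := α⁻¹ * t)
        ((inv_mul_lt_iff₀ hα).2 ht)
      exact ⟨x, (inv_mul_lt_iff₀ hα).1 hx⟩)
    (fun t ht => by
      rw [← hαG] at ht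
      obtain ⟨x, hx⟩ := exists_lt_of_lt_ciSup (f := g) (b := α * t)
        ((lt_inv_mul_iff₀ hα).1 ht)
      exact ⟨x, (lt_inv_mul_iff₀ hα).2 hx⟩)
    (fun x y => by
      convert H x y using 1
      field_simp)
  simp only [ENNReal.ofReal_mul hα.le, ENNReal.ofReal_mul (inv_pos.2 hα).le] at key
  rw [lintegral_const_mul _ (by fun_prop), lintegral_const_mul _ (by fun_prop)] at key
  set I := ∫⁻ x, ENNReal.ofReal (f x)
  set J := ∫⁻ x, ENNReal.ofReal (g x)
  have h1 : ENNReal.ofReal α * ENNReal.ofReal α⁻¹ = 1 := by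
    rw [← ENNReal.ofReal_mul hα.le, mul_inv_cancel₀ hα.ne', ENNReal.ofReal_one]
  have h2 : 4 * (I * J) ≤ 4 * (∫⁻ x, ENNReal.ofReal (h x)) ^ 2 := by
    calc 4 * (I * J) = 4 * ((ENNReal.ofReal α * I) * (ENNReal.ofReal α⁻¹ * J)) := by
          rw [mul_mul_mul_comm, h1, one_mul]
      _ ≤ (ENNReal.ofReal α * I + ENNReal.ofReal α⁻¹ * J) ^ 2 := four_mul_mul_le_add_sq _ _
      _ ≤ (2 * ∫⁻ x, ENNReal.ofReal (h x)) ^ 2 := by gcongr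
      _ = _ := by rw [mul_pow]; norm_num
  exact (ENNReal.mul_le_mul_iff_right (by norm_num) (by norm_num)).1 h2

/-- The Prékopa–Leindler inequality on the line, for midpoints. -/
theorem lintegral_mul_lintegral_le_of_midpoint {f g h : ℝ → ENNReal} (hf : Measurable f)
    (hg : Measurable g) (hh : Measurable h) (H : ∀ x y, f x * g y ≤ h ((x + y) / 2) ^ 2) :
    (∫⁻ x, f x) * ∫⁻ x, g x ≤ (∫⁻ x, h x) ^ 2 := by
  -- Truncation at height `N` reduces to bounded functions, by monotone convergence.
  have trunc : ∀ {u : ℝ → ENNReal}, Measurable u →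
      ∫⁻ x, u x = ⨆ N : ℕ, ∫⁻ x, min (u x) N := by
    intro u hu
    rw [← lintegral_iSup (fun N => hu.min measurable_const)
      (fun N N' hN x => min_le_min_left _ (by exact_mod_cast hN))]
    congr with x
    rw [← inf_iSup_eq, ENNReal.iSup_natCast, inf_top_eq]
  have mono : ∀ {u : ℝ → ENNReal}, Monotone fun N : ℕ => ∫⁻ x, min (u x) N :=
    fun {_} N N' hN => lintegral_mono fun x => min_le_min_left _ (by exact_mod_cast hN)
  rw [trunc hf, trunc hg, ENNReal.iSup_mul]
  refine iSup_le fun N₁ => ?_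
  rw [ENNReal.mul_iSup]
  refine iSup_le fun N₂ => (mul_le_mul' (mono (le_max_left N₁ N₂)) (mono (le_max_right N₁ N₂))).trans ?_
  generalize max N₁ N₂ = N
  have fin : ∀ u : ENNReal, min u N ≠ ⊤ := fun u =>
    ne_top_of_le_ne_top (ENNReal.natCast_ne_top N) (min_le_right _ _)
  have key := lintegral_mul_lintegral_le_of_midpoint_of_le (M := N)
    (f := fun x => (min (f x) N).toReal) (g := fun x => (min (g x) N).toReal)
    (h := fun x => (min (h x) N).toReal) (hf.min measurable_const).ennreal_toReal
    (hg.min measurable_const).ennreal_toReal (hh.min measurable_const).ennreal_toReal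
    (fun x => ENNReal.toReal_nonneg) (fun x => ENNReal.toReal_nonneg)
    (fun x => ENNReal.toReal_nonneg)
    (fun x => by simpa using ENNReal.toReal_mono (ENNReal.natCast_ne_top N) (min_le_right (f x) N))
    (fun x => by simpa using ENNReal.toReal_mono (ENNReal.natCast_ne_top N) (min_le_right (g x) N))
    (fun x y => by
      rw [← ENNReal.toReal_mul, ← ENNReal.toReal_pow]
      refine ENNReal.toReal_mono (ENNReal.pow_ne_top (fin _)) ?_
      rcases min_choice (h ((x + y) / 2)) (N : ENNReal) with h1 | h1 <;> rw [h1]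
      · exact (mul_le_mul' (min_le_left _ _) (min_le_left _ _)).trans (H x y)
      · rw [sq]
        exact mul_le_mul' (min_le_right _ _) (min_le_right _ _))
  simp only [ENNReal.ofReal_toReal (fin _)] at key
  refine key.trans ?_
  gcongr
  exact min_le_left _ _

/-! ### Prékopa–Leindler in several variables, by induction on dimension -/

theorem measurable_insertNth {k : ℕ} (n : Fin (k + 1)) :
    Measurable fun p : ℝ × (Fin k → ℝ) => (n.insertNth p.1 p.2 : Fin (k + 1) → ℝ) :=
  (MeasurableEquiv.piFinSuccAbove (fun _ : Fin (k + 1) => ℝ) n).symm.measurable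

theorem lintegral_eq_lintegral_insertNth {k : ℕ} (n : Fin (k + 1))
    {u : (Fin (k + 1) → ℝ) → ENNReal} (hu : Measurable u) :
    ∫⁻ x, u x = ∫⁻ a : ℝ, ∫⁻ w : Fin k → ℝ, u (n.insertNth a w) := by
  have e := (volume_preserving_piFinSuccAbove (fun _ : Fin (k + 1) => ℝ) n).symm
  rw [← e.lintegral_comp hu, Measure.volume_eq_prod, lintegral_prod _ (by fun_prop)]
  rfl

/-- The Prékopa–Leindler inequality, for midpoints. -/
theorem lintegral_pi_mul_lintegral_pi_le_of_midpoint (k : ℕ) {f g h : (Fin k → ℝ) → ENNReal}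
    (hf : Measurable f) (hg : Measurable g) (hh : Measurable h)
    (H : ∀ x y, f x * g y ≤ h (fun i => (x i + y i) / 2) ^ 2) :
    (∫⁻ x, f x) * ∫⁻ x, g x ≤ (∫⁻ x, h x) ^ 2 := by
  induction k with
  | zero =>
    have e : ∀ u : (Fin 0 → ℝ) → ENNReal, ∫⁻ x, u x = u default := fun u => by
      rw [lintegral_unique, volume_pi, Measure.pi_of_empty _ default]
      simp only [Measure.dirac_apply_of_mem (Set.mem_univ _), mul_one]
      exact congrArg u (Subsingleton.elim _ _)
    rw [e, e, e]
    convert H default default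
  | succ k ih =>
    have m : ∀ {u : (Fin (k + 1) → ℝ) → ENNReal}, Measurable u →
        Measurable fun p : ℝ × (Fin k → ℝ) => u ((0 : Fin (k + 1)).insertNth p.1 p.2) :=
      fun hu => hu.comp (measurable_insertNth 0)
    rw [lintegral_eq_lintegral_insertNth 0 hf, lintegral_eq_lintegral_insertNth 0 hg,
      lintegral_eq_lintegral_insertNth 0 hh]
    refine lintegral_mul_lintegral_le_of_midpoint (m hf).lintegral_prod_right'
      (m hg).lintegral_prod_right' (m hh).lintegral_prod_right' fun a b => ?_
    refine ih ((m hf).comp measurable_prodMk_left) ((m hg).comp measurable_prodMk_left)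
      ((m hh).comp measurable_prodMk_left) fun x y => ?_
    convert H ((0 : Fin (k + 1)).insertNth a x) ((0 : Fin (k + 1)).insertNth b y) using 3
    ext i
    refine Fin.cases ?_ (fun j => ?_) i <;> simp

/-! ### Geometric means and log-concavity in the precision -/

/-- The Prékopa–Leindler inequality on the half-line, for geometric means. -/
theorem lintegral_Ioi_mul_lintegral_Ioi_le_of_geom_mean {f g h : ℝ → ENNReal} (hf : Measurable f)
    (hg : Measurable g) (hh : Measurable h)
    (H : ∀ x y, 0 < x → 0 < y → f x * g y ≤ h (√(x * y)) ^ 2) :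
    (∫⁻ x in Set.Ioi 0, f x) * ∫⁻ x in Set.Ioi 0, g x ≤ (∫⁻ x in Set.Ioi 0, h x) ^ 2 := by
  have e : ∀ u : ℝ → ENNReal, ∫⁻ x in Set.Ioi 0, u x =
      ∫⁻ x, ENNReal.ofReal (Real.exp x) * u (Real.exp x) := by
    intro u
    have := lintegral_image_eq_lintegral_abs_deriv_mul (f := Real.exp) (f' := Real.exp)
      MeasurableSet.univ (fun x _ => (Real.hasDerivAt_exp x).hasDerivWithinAt)
      Real.exp_injective.injOn u
    simpa [Set.image_univ, Real.range_exp] using this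
  rw [e, e, e]
  -- In logarithmic coordinates geometric means are midpoints, and the Jacobians match exactly: `exp
  -- x * exp y = exp ((x + y) / 2) ^ 2`.
  refine lintegral_mul_lintegral_le_of_midpoint (by fun_prop) (by fun_prop) (by fun_prop) ?_
  intro x y
  have h1 : √(Real.exp x * Real.exp y) = Real.exp ((x + y) / 2) := by
    rw [← Real.exp_add, Real.exp_half]
  have := H _ _ (Real.exp_pos x) (Real.exp_pos y)
  rw [h1] at this
  rw [mul_mul_mul_comm, mul_pow, ← ENNReal.ofReal_mul (Real.exp_pos x).le, ← Real.exp_add,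
    ← ENNReal.ofReal_pow (Real.exp_pos _).le, ← Real.exp_nat_mul]
  refine (mul_le_mul' le_rfl this).trans_eq ?_
  congr 3
  push_cast
  ring

theorem lintegral_eq_two_mul_lintegral_Ioi_of_even {f : ℝ → ENNReal} (hf : ∀ x, f (-x) = f x) :
    ∫⁻ x, f x = 2 * ∫⁻ x in Set.Ioi 0, f x := by
  have h1 : ∫⁻ x in Set.Iio 0, f x = ∫⁻ x in Set.Ioi 0, f x := by
    have := (Measure.measurePreserving_neg (volume : Measure ℝ)).setLIntegral_comp_preimage_emb
      (MeasurableEquiv.neg ℝ).measurableEmbedding f (Set.Iio 0)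
    rw [← this]
    simp [hf]
  rw [← lintegral_add_compl f measurableSet_Ioi, Set.compl_Ioi,
    setLIntegral_congr Iio_ae_eq_Iic.symm, h1, two_mul]

open Classical in
/-- The unnormalized truncated Gaussian weight on `ℝ × ℝᵏ`, with precision `τ` in the first
variable. -/
noncomputable def splitWeight {k : ℕ} (ρ : ℝ) (q : Fin k → ℝ) (τ : ℝ) (p : ℝ × (Fin k → ℝ)) :
    ENNReal :=
  if p.1 ^ 2 + ∑ i, p.2 i ^ 2 < ρ then
    ENNReal.ofReal (Real.exp (-(τ * p.1 ^ 2 / 2 + ∑ i, q i * p.2 i ^ 2))) else 0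

theorem measurable_splitWeight {k : ℕ} (ρ : ℝ) (q : Fin k → ℝ) (τ : ℝ) :
    Measurable (splitWeight ρ q τ) := by
  unfold splitWeight
  refine Measurable.ite (measurableSet_lt ?_ measurable_const) ?_ measurable_const <;> fun_prop

theorem splitWeight_mul_le {k : ℕ} {ρ : ℝ} {q : Fin k → ℝ} (hq : ∀ i, 0 ≤ q i) {a b x y : ℝ}
    (ha : 0 ≤ a) (hb : 0 ≤ b) (hx : 0 ≤ x) (hy : 0 ≤ y) (w z : Fin k → ℝ) :
    splitWeight ρ q a (x, w) * splitWeight ρ q b (y, z) ≤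
      splitWeight ρ q (√(a * b)) (√(x * y), fun i => (w i + z i) / 2) ^ 2 := by
  have hm : ∀ i, ((w i + z i) / 2) ^ 2 ≤ (w i ^ 2 + z i ^ 2) / 2 := fun i => by
    nlinarith [sq_nonneg (w i - z i)]
  have hxy : √(x * y) ^ 2 = x * y := Real.sq_sqrt (mul_nonneg hx hy)
  by_cases h1 : x ^ 2 + ∑ i, w i ^ 2 < ρ
  swap
  · simp [splitWeight, h1]
  by_cases h2 : y ^ 2 + ∑ i, z i ^ 2 < ρ
  swap
  · simp [splitWeight, h2]
  have s1 : ∑ i, ((w i + z i) / 2) ^ 2 ≤ (∑ i, w i ^ 2 + ∑ i, z i ^ 2) / 2 := by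
    rw [← Finset.sum_add_distrib, Finset.sum_div]
    exact Finset.sum_le_sum fun i _ => hm i
  have s2 : ∑ i, q i * ((w i + z i) / 2) ^ 2 ≤
      (∑ i, q i * w i ^ 2 + ∑ i, q i * z i ^ 2) / 2 := by
    rw [← Finset.sum_add_distrib, Finset.sum_div]
    refine Finset.sum_le_sum fun i _ => ?_
    have := mul_le_mul_of_nonneg_left (hm i) (hq i)
    linarith
  have h3 : √(x * y) ^ 2 + ∑ i, ((w i + z i) / 2) ^ 2 < ρ := by
    rw [hxy]
    nlinarith [sq_nonneg (x - y)]
  have hab : √(a * b) * (x * y) ≤ (a * x ^ 2 + b * y ^ 2) / 2 := by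
    rw [Real.sqrt_mul ha]
    have e1 := Real.sq_sqrt ha
    have e2 := Real.sq_sqrt hb
    have := two_mul_le_add_sq (√a * x) (√b * y)
    rw [mul_pow, mul_pow, e1, e2] at this
    linarith
  simp only [splitWeight, h1, h2, h3, if_true]
  rw [← ENNReal.ofReal_mul (Real.exp_pos _).le, ← ENNReal.ofReal_pow (Real.exp_pos _).le,
    ← Real.exp_add, ← Real.exp_nat_mul]
  refine ENNReal.ofReal_le_ofReal (Real.exp_le_exp.2 ?_)
  rw [hxy]
  push_cast
  linarith

/-- Evenness in the first variable reduces to the half-line, where geometric means make sense. The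
arithmetic-mean inequality in `w` supplies the hypothesis of the geometric-mean one in `x`. -/
theorem lintegral_splitWeight_mul_le {k : ℕ} {ρ : ℝ} {q : Fin k → ℝ} (hq : ∀ i, 0 ≤ q i)
    {a b : ℝ} (ha : 0 ≤ a) (hb : 0 ≤ b) :
    (∫⁻ x, ∫⁻ w, splitWeight ρ q a (x, w)) * (∫⁻ x, ∫⁻ w, splitWeight ρ q b (x, w)) ≤
      (∫⁻ x, ∫⁻ w, splitWeight ρ q (√(a * b)) (x, w)) ^ 2 := by
  have even : ∀ τ x, ∫⁻ w, splitWeight ρ q τ (-x, w) = ∫⁻ w, splitWeight ρ q τ (x, w) :=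
    fun τ x => by simp [splitWeight]
  have m := measurable_splitWeight ρ q
  rw [lintegral_eq_two_mul_lintegral_Ioi_of_even (even a),
    lintegral_eq_two_mul_lintegral_Ioi_of_even (even b),
    lintegral_eq_two_mul_lintegral_Ioi_of_even (even _), mul_mul_mul_comm, mul_pow, sq (2 : ENNReal)]
  refine mul_le_mul' le_rfl (lintegral_Ioi_mul_lintegral_Ioi_le_of_geom_mean
    (m a).lintegral_prod_right' (m b).lintegral_prod_right' (m _).lintegral_prod_right' ?_)
  intro x y hx hy
  exact lintegral_pi_mul_lintegral_pi_le_of_midpoint k ((m a).comp measurable_prodMk_left)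
    ((m b).comp measurable_prodMk_left) ((m _).comp measurable_prodMk_left)
    fun w z => splitWeight_mul_le hq ha hb hx.le hy.le w z

/-- If `c > 0`, then `N (t + h) > N (t - h)` for small `h > 0`, so `L (t + h) + L (t - h)` increases
strictly from its value `2 * L t` at `h = 0`. Differentiability of `N` at `t` alone suffices. -/
theorem deriv_nonpos_of_midpoint_concave {L N : ℝ → ℝ} {t c : ℝ} (hL : ∀ x, HasDerivAt L (N x) x)
    (hN : HasDerivAt N c t) (H : ∀ h, L (t + h) + L (t - h) ≤ 2 * L t) : c ≤ 0 := by
  by_contra! hc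
  set φ : ℝ → ℝ := fun h => L (t + h) + L (t - h)
  have hφ : ∀ h, HasDerivAt φ (N (t + h) - N (t - h)) h := fun h => by
    have h1 : HasDerivAt (fun h => L (t + h)) (N (t + h)) h := (hL _).comp_const_add t h
    have h2 : HasDerivAt (fun h => L (t - h)) (-N (t - h)) h := (hL _).comp_const_sub t h
    exact (h1.add h2).congr_deriv (by ring)
  have hpos : ∀ᶠ h in nhdsWithin 0 (Set.Ioi 0), 0 < N (t + h) - N (t - h) := by
    have h1 : HasDerivAt (fun h => N (t + h)) c 0 := HasDerivAt.comp_const_add t 0 (by simpa using hN)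
    have h2 : HasDerivAt (fun h => N (t - h)) (-c) 0 :=
      HasDerivAt.comp_const_sub t 0 (by simpa using hN)
    have h3 := (h1.sub h2).tendsto_slope_zero_right
    filter_upwards [h3.eventually (lt_mem_nhds (show 0 < c - -c by linarith)),
      self_mem_nhdsWithin] with h hh hh0
    simp only [zero_add, Pi.sub_apply, add_zero, sub_zero, sub_self, smul_eq_mul] at hh
    exact (pos_iff_pos_of_mul_pos hh).1 (inv_pos.2 hh0)
  obtain ⟨ε, hε, hεpos⟩ := mem_nhdsGT_iff_exists_Ioo_subset.1 hpos
  have hε' : (0 : ℝ) < ε / 2 := half_pos hε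
  have hmono : StrictMonoOn φ (Set.Icc 0 (ε / 2)) := by
    refine strictMonoOn_of_deriv_pos (convex_Icc _ _)
      (fun h _ => (hφ h).continuousAt.continuousWithinAt) fun h hh => ?_
    rw [interior_Icc] at hh
    rw [(hφ h).deriv]
    exact hεpos ⟨hh.1, by linarith [hh.2]⟩
  have h1 := hmono (Set.left_mem_Icc.2 hε'.le) (Set.right_mem_Icc.2 hε'.le) hε'
  have h2 := H (ε / 2)
  simp only [φ, add_zero, sub_zero] at h1
  linarith

/-! ### Unnormalized moments on the ball -/

variable {ν : ℕ}

theorem dotProduct_self_eq_sum_sq (x : Fin ν → ℝ) : x ⬝ᵥ x = ∑ m, x m ^ 2 := by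
  simp [dotProduct, sq]

theorem isOpen_ball (ν : ℕ) (ρ : ℝ) : IsOpen (ball ν ρ) := by
  unfold ball
  simp only [dotProduct_self_eq_sum_sq]
  exact isOpen_lt (by fun_prop) continuous_const

theorem sq_le_of_mem_ball {ρ : ℝ} {x : Fin ν → ℝ} (hx : x ∈ ball ν ρ) (m : Fin ν) :
    x m ^ 2 ≤ ρ := by
  have h1 : ∑ m, x m ^ 2 < ρ := by rw [← dotProduct_self_eq_sum_sq]; exact hx
  exact (Finset.single_le_sum (f := fun m => x m ^ 2) (fun i _ => sq_nonneg _)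
    (Finset.mem_univ m)).trans h1.le

theorem volume_ball_lt_top (ν : ℕ) (ρ : ℝ) : volume (ball ν ρ) < ⊤ := by
  have hsub : ball ν ρ ⊆ Set.Icc (fun _ => -√ρ) (fun _ => √ρ) := fun x hx =>
    ⟨fun m => (abs_le.1 (Real.abs_le_sqrt (sq_le_of_mem_ball hx m))).1,
      fun m => (abs_le.1 (Real.abs_le_sqrt (sq_le_of_mem_ball hx m))).2⟩
  exact (measure_mono hsub).trans_lt isCompact_Icc.measure_lt_top

theorem volume_ball_pos (ν : ℕ) {ρ : ℝ} (hρ : 0 < ρ) : 0 < volume (ball ν ρ) :=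
  (isOpen_ball ν ρ).measure_pos _ ⟨0, by simpa [ball] using hρ⟩

/-- The unnormalized Gaussian weight with variances `lam`, except that the coordinate `n` has
precision `τ`. -/
noncomputable def weight (lam : Fin ν → ℝ) (n : Fin ν) (τ : ℝ) (x : Fin ν → ℝ) : ℝ :=
  Real.exp (-(τ * x n ^ 2 / 2)) * Real.exp (-∑ m ∈ Finset.univ.erase n, x m ^ 2 / (2 * lam m))

/-- The unnormalized moments of `x n ^ 2` on the ball. -/
noncomputable def moment (lam : Fin ν → ℝ) (ρ : ℝ) (n : Fin ν) (j : ℕ) (τ : ℝ) : ℝ :=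
  ∫ x in ball ν ρ, (x n ^ 2) ^ j * weight lam n τ x

theorem weight_pos (lam : Fin ν → ℝ) (n : Fin ν) (τ : ℝ) (x : Fin ν → ℝ) :
    0 < weight lam n τ x := mul_pos (Real.exp_pos _) (Real.exp_pos _)

@[fun_prop]
theorem continuous_weight (lam : Fin ν → ℝ) (n : Fin ν) (τ : ℝ) :
    Continuous (weight lam n τ) := by
  unfold weight
  fun_prop

theorem weight_le {lam : Fin ν → ℝ} (hlam : ∀ m, 0 < lam m) {ρ τ T : ℝ} (n : Fin ν)
    (hτ : |τ| ≤ T) {x : Fin ν → ℝ} (hx : x ∈ ball ν ρ) :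
    weight lam n τ x ≤ Real.exp (T * ρ) := by
  have h1 : Real.exp (-∑ m ∈ Finset.univ.erase n, x m ^ 2 / (2 * lam m)) ≤ 1 := by
    rw [Real.exp_le_one_iff, neg_nonpos]
    refine Finset.sum_nonneg fun m _ => ?_
    have := hlam m
    positivity
  have h2 : -(τ * x n ^ 2 / 2) ≤ T * ρ := by
    have h3 := sq_le_of_mem_ball hx n
    have h4 : -τ * x n ^ 2 ≤ T * x n ^ 2 :=
      mul_le_mul_of_nonneg_right ((neg_le_abs τ).trans hτ) (sq_nonneg _)
    have h5 : T * x n ^ 2 ≤ T * ρ := mul_le_mul_of_nonneg_left h3 ((abs_nonneg τ).trans hτ)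
    have h6 : 0 ≤ T * x n ^ 2 := mul_nonneg ((abs_nonneg τ).trans hτ) (sq_nonneg _)
    linarith
  calc weight lam n τ x ≤ Real.exp (T * ρ) * 1 :=
        mul_le_mul (Real.exp_le_exp.2 h2) h1 (Real.exp_pos _).le (Real.exp_pos _).le
    _ = _ := mul_one _

theorem norm_pow_mul_weight_le {lam : Fin ν → ℝ} (hlam : ∀ m, 0 < lam m) {ρ τ T : ℝ} (n : Fin ν)
    (j : ℕ) (hτ : |τ| ≤ T) {x : Fin ν → ℝ} (hx : x ∈ ball ν ρ) :
    ‖(x n ^ 2) ^ j * weight lam n τ x‖ ≤ ρ ^ j * Real.exp (T * ρ) := by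
  have h1 := weight_pos lam n τ x
  rw [Real.norm_of_nonneg (by positivity)]
  have h2 := sq_le_of_mem_ball hx n
  have h3 := weight_le hlam n hτ hx
  have h4 : 0 ≤ ρ := (sq_nonneg _).trans h2
  gcongr

theorem integrableOn_pow_mul_weight {lam : Fin ν → ℝ} (hlam : ∀ m, 0 < lam m) (ρ : ℝ) (n : Fin ν)
    (j : ℕ) (τ : ℝ) : IntegrableOn (fun x => (x n ^ 2) ^ j * weight lam n τ x) (ball ν ρ) := by
  refine IntegrableOn.of_bound (volume_ball_lt_top ν ρ)
    (Continuous.aestronglyMeasurable (by fun_prop)) (ρ ^ j * Real.exp (|τ| * ρ)) ?_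
  exact (ae_restrict_mem (isOpen_ball ν ρ).measurableSet).mono fun x hx =>
    norm_pow_mul_weight_le hlam n j le_rfl hx

theorem moment_zero_pos {lam : Fin ν → ℝ} (hlam : ∀ m, 0 < lam m) {ρ : ℝ} (hρ : 0 < ρ)
    (n : Fin ν) (τ : ℝ) : 0 < moment lam ρ n 0 τ := by
  unfold moment
  rw [setIntegral_pos_iff_support_of_nonneg_ae
    (.of_forall fun x => by have := weight_pos lam n τ x; simp [this.le])
    (integrableOn_pow_mul_weight hlam ρ n 0 τ)]
  convert volume_ball_pos ν hρ using 2
  refine Set.inter_eq_right.2 fun x _ => ?_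
  simp [(weight_pos lam n τ x).ne']

/-- Differentiating in `τ` brings down `-xₙ² / 2`. Domination is by a constant, since the ball is
bounded and `|τ'| ≤ |τ| + 1` near `τ`. -/
theorem hasDerivAt_moment {lam : Fin ν → ℝ} (hlam : ∀ m, 0 < lam m) (ρ : ℝ) (n : Fin ν)
    (j : ℕ) (τ : ℝ) :
    HasDerivAt (moment lam ρ n j) (-(moment lam ρ n (j + 1) τ / 2)) τ := by
  have key := hasDerivAt_integral_of_dominated_loc_of_deriv_le (𝕜 := ℝ)
    (μ := volume.restrict (ball ν ρ)) (x₀ := τ) (s := Metric.ball τ 1)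
    (F := fun τ x => (x n ^ 2) ^ j * weight lam n τ x)
    (F' := fun τ x => (-(1 / 2) : ℝ) * ((x n ^ 2) ^ (j + 1) * weight lam n τ x))
    (bound := fun _ => (1 / 2) * (ρ ^ (j + 1) * Real.exp ((|τ| + 1) * ρ)))
    (Metric.ball_mem_nhds τ one_pos)
    (.of_forall fun τ => (integrableOn_pow_mul_weight hlam ρ n j τ).aestronglyMeasurable)
    (integrableOn_pow_mul_weight hlam ρ n j τ)
    ((integrableOn_pow_mul_weight hlam ρ n (j + 1) τ).aestronglyMeasurable.const_mul _)
    ((ae_restrict_mem (isOpen_ball ν ρ).measurableSet).mono fun x hx τ' hτ' => by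
      rw [norm_mul]
      have h1 : |τ'| ≤ |τ| + 1 := by
        have h2 := abs_sub_abs_le_abs_sub τ' τ
        have h3 : |τ' - τ| < 1 := hτ'
        linarith
      have h4 := norm_pow_mul_weight_le hlam n (j + 1) h1 hx
      have h5 : ‖(-(1 / 2) : ℝ)‖ = 1 / 2 := by norm_num
      rw [h5]
      gcongr)
    (integrableOn_const (volume_ball_lt_top ν ρ).ne)
    (.of_forall fun x τ' _ => by
      unfold weight
      have h1 : HasDerivAt (fun τ : ℝ => -(τ * x n ^ 2 / 2)) (-(1 * x n ^ 2 / 2)) τ' :=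
        (((hasDerivAt_id τ').mul_const _).div_const 2).neg
      exact ((h1.exp.mul_const _).const_mul ((x n ^ 2) ^ j)).congr_deriv (by ring))
  refine key.2.congr_deriv ?_
  rw [integral_const_mul]
  unfold moment
  ring

theorem ofReal_moment_zero {k : ℕ} {lam : Fin (k + 1) → ℝ} (hlam : ∀ m, 0 < lam m) (ρ : ℝ)
    (n : Fin (k + 1)) (τ : ℝ) :
    ENNReal.ofReal (moment lam ρ n 0 τ) =
      ∫⁻ a, ∫⁻ w, splitWeight ρ (fun i => 1 / (2 * lam (n.succAbove i))) τ (a, w) := by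
  unfold moment
  rw [ofReal_integral_eq_lintegral_ofReal (integrableOn_pow_mul_weight hlam ρ n 0 τ)
    (.of_forall fun x => by have := weight_pos lam n τ x; simp [this.le]),
    ← lintegral_indicator (isOpen_ball _ ρ).measurableSet, lintegral_eq_lintegral_insertNth n]
  · congr! 4 with a w
    have h1 : (n.insertNth a w : Fin (k + 1) → ℝ) ∈ ball (k + 1) ρ ↔
        a ^ 2 + ∑ i, w i ^ 2 < ρ := by
      simp [ball, dotProduct_self_eq_sum_sq, Fin.sum_univ_succAbove _ n]
    have h2 : weight lam n τ (n.insertNth a w) =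
        Real.exp (-(τ * a ^ 2 / 2 + ∑ i, 1 / (2 * lam (n.succAbove i)) * w i ^ 2)) := by
      have h3 : ∑ m ∈ Finset.univ.erase n,
          (n.insertNth a w : Fin (k + 1) → ℝ) m ^ 2 / (2 * lam m) =
          ∑ i, 1 / (2 * lam (n.succAbove i)) * w i ^ 2 := by
        rw [Finset.sum_erase_eq_sub (Finset.mem_univ n), Fin.sum_univ_succAbove _ n,
          add_sub_cancel_left]
        refine Finset.sum_congr rfl fun i _ => ?_
        simp only [Fin.insertNth_apply_succAbove]
        ring
      rw [weight, h3, ← Real.exp_add, Fin.insertNth_apply_same]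
      congr 1
      ring
    by_cases h : a ^ 2 + ∑ i, w i ^ 2 < ρ
    · rw [Set.indicator_of_mem (h1.2 h), splitWeight, if_pos h, h2]
      simp
    · rw [Set.indicator_of_notMem (mt h1.1 h), splitWeight, if_neg h]
  · exact Measurable.indicator (Continuous.measurable (by fun_prop)).ennreal_ofReal
      (isOpen_ball _ ρ).measurableSet

theorem moment_zero_mul_le {lam : Fin ν → ℝ} (hlam : ∀ m, 0 < lam m) {ρ : ℝ} (hρ : 0 < ρ)
    (n : Fin ν) {a b : ℝ} (ha : 0 ≤ a) (hb : 0 ≤ b) :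
    moment lam ρ n 0 a * moment lam ρ n 0 b ≤ moment lam ρ n 0 (√(a * b)) ^ 2 := by
  cases ν with
  | zero => exact n.elim0
  | succ k =>
    have p := fun τ => (moment_zero_pos hlam hρ n τ).le
    rw [← ENNReal.ofReal_le_ofReal_iff (sq_nonneg _), ENNReal.ofReal_mul (p a),
      ENNReal.ofReal_pow (p _), ofReal_moment_zero hlam, ofReal_moment_zero hlam,
      ofReal_moment_zero hlam]
    exact lintegral_splitWeight_mul_le (fun i => by have := hlam (n.succAbove i); positivity) ha hb

/-- The Gaussian variance bound, in terms of unnormalized moments. -/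
theorem moment_variance_le {lam : Fin ν → ℝ} (hlam : ∀ m, 0 < lam m) {ρ : ℝ} (hρ : 0 < ρ)
    (n : Fin ν) {τ : ℝ} (hτ : 0 < τ) :
    τ * (moment lam ρ n 2 τ * moment lam ρ n 0 τ - moment lam ρ n 1 τ ^ 2) ≤
      2 * (moment lam ρ n 1 τ * moment lam ρ n 0 τ) := by
  set A := moment lam ρ n
  have p : ∀ τ, 0 < A 0 τ := moment_zero_pos hlam hρ n
  have d : ∀ j t, HasDerivAt (fun t => A j (Real.exp t))
      (-(A (j + 1) (Real.exp t) / 2) * Real.exp t) t := fun j t =>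
    (hasDerivAt_moment hlam ρ n j (Real.exp t)).comp t (Real.hasDerivAt_exp t)
  have hL : ∀ t, HasDerivAt (fun t => Real.log (A 0 (Real.exp t)))
      (-(A 1 (Real.exp t) / 2) * Real.exp t / A 0 (Real.exp t)) t := fun t =>
    (d 0 t).log (p _).ne'
  have hN := ((((d 1 (Real.log τ)).div_const 2).neg.mul (Real.hasDerivAt_exp _)).div
    (d 0 (Real.log τ)) (p _).ne')
  -- The precisions `exp (log τ ± h)` have geometric mean `τ`.
  have key := deriv_nonpos_of_midpoint_concave hL hN fun h => by
    rw [← Real.log_mul (p _).ne' (p _).ne', two_mul, ← Real.log_mul (p _).ne' (p _).ne', ← sq]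
    refine Real.log_le_log (mul_pos (p _) (p _)) ?_
    convert moment_zero_mul_le hlam hρ n (Real.exp_pos (Real.log τ + h)).le
      (Real.exp_pos (Real.log τ - h)).le using 3
    rw [← Real.exp_add, ← Real.exp_half]
    congr 1
    ring
  simp only [Pi.neg_apply, Pi.mul_apply, Real.exp_log hτ] at key
  rw [div_le_iff₀ (pow_pos (p _) 2), zero_mul] at key
  -- The chain rule through `exp` leaves one extra factor `τ`, cancelled at the end.
  have h1 : τ * (τ * (A 2 τ * A 0 τ - A 1 τ ^ 2)) ≤ τ * (2 * (A 1 τ * A 0 τ)) := by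
    norm_num at key
    linarith
  exact le_of_mul_le_mul_left h1 hτ

/-- The weight sees coordinate `n` only through `τ`, so varying `λₙ` just moves the argument of a
fixed function. -/
theorem moment_update (lam : Fin ν → ℝ) (ρ : ℝ) (n : Fin ν) (s : ℝ) :
    moment (Function.update lam n s) ρ n = moment lam ρ n := by
  have h : weight (Function.update lam n s) n = weight lam n := by
    funext τ x
    unfold weight
    congr 3
    refine Finset.sum_congr rfl fun m hm => ?_
    rw [Function.update_of_ne (Finset.ne_of_mem_erase hm)]
  unfold moment
  rw [h]

/-! ### From moments to the truncated normal law -/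

theorem normalDensity_eq (lam : Fin ν → ℝ) (hlam : ∀ m, 0 < lam m) (n : Fin ν) :
    ∃ C > 0, ∀ x, normalDensity lam x = C * weight lam n (lam n)⁻¹ x := by
  refine ⟨∏ m, (√(lam m))⁻¹ * (√(2 * Real.pi))⁻¹, Finset.prod_pos fun m _ => ?_, fun x => ?_⟩
  · have := hlam m
    positivity
  have h : ∀ m, (√(lam m))⁻¹ * gaussianPDFReal 0 1 ((√(lam m))⁻¹ * x m) =
      (√(lam m))⁻¹ * (√(2 * Real.pi))⁻¹ * Real.exp (-(x m ^ 2 / (2 * lam m))) := fun m => by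
    rw [gaussianPDFReal, ← mul_assoc]
    congr 2
    · simp
    · rw [sub_zero, mul_pow, inv_pow, Real.sq_sqrt (hlam m).le, NNReal.coe_one]
      have := (hlam m).ne'
      field_simp
  rw [normalDensity, Finset.prod_congr rfl fun m _ => h m, Finset.prod_mul_distrib, ← Real.exp_sum,
    Finset.sum_neg_distrib, ← Finset.add_sum_erase _ _ (Finset.mem_univ n), neg_add, Real.exp_add,
    weight]
  congr 4
  have := (hlam n).ne'
  field_simp

theorem measurable_density (lam : Fin ν → ℝ) (ρ : ℝ) : Measurable (density lam ρ) := by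
  unfold density
  refine Measurable.ite (isOpen_ball ν ρ).measurableSet ?_ measurable_const
  unfold normalDensity
  fun_prop

/-- The moments of `x n ^ 2` under the truncated normal law. -/
theorem integral_law_pow {lam : Fin ν → ℝ} (hlam : ∀ m, 0 < lam m) {ρ : ℝ} (hρ : 0 < ρ)
    (n : Fin ν) (j : ℕ) :
    ∫ x, (x n ^ 2) ^ j ∂(law lam ρ) = moment lam ρ n j (lam n)⁻¹ / moment lam ρ n 0 (lam n)⁻¹ := by
  obtain ⟨C, hC, h⟩ := normalDensity_eq lam hlam n
  have h0 := moment_zero_pos hlam hρ n (lam n)⁻¹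
  have hk : normConst lam ρ = (C * moment lam ρ n 0 (lam n)⁻¹)⁻¹ := by
    simp only [normConst, h, integral_const_mul, moment, pow_zero, one_mul]
  have hd : ∀ x, (ENNReal.ofReal (density lam ρ x)).toReal = density lam ρ x := fun x => by
    refine ENNReal.toReal_ofReal ?_
    unfold density
    split_ifs
    · rw [hk, h]
      have := weight_pos lam n (lam n)⁻¹ x
      positivity
    · exact le_rfl
  rw [law, integral_withDensity_eq_integral_toReal_smul (measurable_density lam ρ).ennreal_ofReal
    (.of_forall fun x => ENNReal.ofReal_lt_top)]
  have hi : ∀ x, (ENNReal.ofReal (density lam ρ x)).toReal • (x n ^ 2) ^ j =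
      (ball ν ρ).indicator (fun x => (moment lam ρ n 0 (lam n)⁻¹)⁻¹ *
        ((x n ^ 2) ^ j * weight lam n (lam n)⁻¹ x)) x := fun x => by
    rw [hd, smul_eq_mul]
    unfold density
    split_ifs with hx
    · rw [Set.indicator_of_mem hx, hk, h]
      field_simp
    · rw [Set.indicator_of_notMem hx, zero_mul]
  simp only [hi]
  rw [integral_indicator (isOpen_ball ν ρ).measurableSet, integral_const_mul, inv_mul_eq_div]
  rfl

theorem isProbabilityMeasure_law {lam : Fin ν → ℝ} (hlam : ∀ m, 0 < lam m) {ρ : ℝ} (hρ : 0 < ρ)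
    (n : Fin ν) : IsProbabilityMeasure (law lam ρ) := by
  have h := integral_law_pow hlam hρ n 0
  rw [div_self (moment_zero_pos hlam hρ n _).ne'] at h
  simp only [pow_zero, integral_const, smul_eq_mul, mul_one] at h
  exact ⟨by rw [← ENNReal.toReal_eq_one_iff]; exact h⟩

theorem memLp_sq_law {lam : Fin ν → ℝ} (hlam : ∀ m, 0 < lam m) {ρ : ℝ} (hρ : 0 < ρ)
    (n : Fin ν) : MemLp (fun x => x n ^ 2) 2 (law lam ρ) := by
  have := isProbabilityMeasure_law hlam hρ n
  refine MemLp.of_bound (Measurable.aestronglyMeasurable (by fun_prop)) ρ ?_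
  rw [law, ae_withDensity_iff (measurable_density lam ρ).ennreal_ofReal]
  refine .of_forall fun x hx => ?_
  rw [Real.norm_of_nonneg (sq_nonneg _)]
  refine sq_le_of_mem_ball (by_contra fun hxb => hx ?_) n
  rw [density, if_neg hxb, ENNReal.ofReal_zero]

theorem variance_sq_law_le {lam : Fin ν → ℝ} (hlam : ∀ m, 0 < lam m) {ρ : ℝ} (hρ : 0 < ρ)
    (n : Fin ν) : variance (fun x => x n ^ 2) (law lam ρ) ≤
      2 * lam n * ∫ x, x n ^ 2 ∂(law lam ρ) := by
  have := isProbabilityMeasure_law hlam hρ n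
  have h1 := integral_law_pow hlam hρ n 1
  have h2 := integral_law_pow hlam hρ n 2
  have h := moment_variance_le hlam hρ n (inv_pos.2 (hlam n))
  have h0 := moment_zero_pos hlam hρ n (lam n)⁻¹
  simp only [pow_one] at h1
  rw [variance_eq_sub (memLp_sq_law hlam hρ n)]
  simp only [Pi.pow_apply]
  rw [h1, h2]
  set A := fun j => moment lam ρ n j (lam n)⁻¹
  change (lam n)⁻¹ * (A 2 * A 0 - A 1 ^ 2) ≤ 2 * (A 1 * A 0) at h
  change A 2 / A 0 - (A 1 / A 0) ^ 2 ≤ 2 * lam n * (A 1 / A 0)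
  rw [inv_mul_le_iff₀ (hlam n)] at h
  change 0 < A 0 at h0
  have e1 : A 2 / A 0 - (A 1 / A 0) ^ 2 = (A 2 * A 0 - A 1 ^ 2) / A 0 ^ 2 := by field_simp
  have e2 : 2 * lam n * (A 1 / A 0) = lam n * (2 * (A 1 * A 0)) / A 0 ^ 2 := by field_simp
  rw [e1, e2]
  gcongr

/-- The expectation is `τ * A 1 τ / A 0 τ` at `τ = 1 / s`. Its `τ`-derivative has numerator `A 1 * A
0 - τ (A 2 * A 0 - A 1²) / 2`, nonnegative by `moment_variance_le`, while `1 / s` decreases. -/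
theorem exists_hasDerivAt_integral_law {lam : Fin ν → ℝ} (hlam : ∀ m, 0 < lam m) {ρ : ℝ}
    (hρ : 0 < ρ) (n : Fin ν) {t : ℝ} (ht : 0 < t) : ∃ d : ℝ, d ≤ 0 ∧
      HasDerivAt (fun s : ℝ => ∫ x, x n ^ 2 / s ∂(law (Function.update lam n s) ρ)) d t := by
  set A := moment lam ρ n
  have p : ∀ τ, 0 < A 0 τ := moment_zero_pos hlam hρ n
  have d : ∀ j, HasDerivAt (A j) (-(A (j + 1) t⁻¹ / 2)) t⁻¹ := fun j =>
    hasDerivAt_moment hlam ρ n j _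
  have hB := (((hasDerivAt_id t⁻¹).mul (d 1)).div (d 0) (p _).ne').comp t (hasDerivAt_inv ht.ne')
  refine ⟨_, ?_, hB.congr_of_eventuallyEq ?_⟩
  · have h := moment_variance_le hlam hρ n (inv_pos.2 ht)
    refine mul_nonpos_of_nonneg_of_nonpos (div_nonneg ?_ (sq_nonneg _)) ?_
    · simp only [Pi.mul_apply, id]
      change t⁻¹ * (A 2 t⁻¹ * A 0 t⁻¹ - A 1 t⁻¹ ^ 2) ≤ 2 * (A 1 t⁻¹ * A 0 t⁻¹) at h
      norm_num
      linarith
    · rw [neg_nonpos]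
      positivity
  -- The moment formula needs `s > 0`, which holds near `t`.
  · filter_upwards [lt_mem_nhds ht] with s hs
    have hlam' : ∀ m, 0 < Function.update lam n s m := fun m => by
      rcases eq_or_ne m n with rfl | hm
      · simpa using hs
      · simpa [hm] using hlam m
    have h1 := integral_law_pow hlam' hρ n 1
    rw [moment_update, Function.update_self] at h1
    simp only [pow_one] at h1
    rw [integral_div, h1]
    simp only [Function.comp, Pi.div_apply, Pi.mul_apply, id, A]
    ring

end TruncNormal

theorem mainTheorem1 (ν : ℕ) (lam : Fin ν → ℝ) (hlam : ∀ m, 0 < lam m)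
    (ρ : ℝ) (hρ : 0 < ρ) (n : Fin ν) :
    IsProbabilityMeasure (TruncNormal.law lam ρ) ∧
    (∀ (Ω : Type*) [MeasurableSpace Ω] (P : Measure Ω) (X : Ω → Fin ν → ℝ),
      HasLaw X (TruncNormal.law lam ρ) P →
        MemLp (fun ω => X ω n ^ 2) 2 P ∧
        variance (fun ω => X ω n ^ 2) P ≤ 2 * lam n * ∫ ω, X ω n ^ 2 ∂P) ∧
    (∀ t : ℝ, 0 < t → ∃ d : ℝ, d ≤ 0 ∧
      HasDerivAt (fun s : ℝ => ∫ x, x n ^ 2 / s ∂(TruncNormal.law (Function.update lam n s) ρ))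
        d t) ∧
    AntitoneOn (fun s : ℝ => ∫ x, x n ^ 2 / s ∂(TruncNormal.law (Function.update lam n s) ρ))
      (Set.Ioi 0) := by
  have hd := fun t ht => TruncNormal.exists_hasDerivAt_integral_law hlam hρ n (t := t) ht
  refine ⟨TruncNormal.isProbabilityMeasure_law hlam hρ n, fun Ω _ P X hX => ⟨?_, ?_⟩, hd, ?_⟩
  · have h := TruncNormal.memLp_sq_law hlam hρ n
    rw [← hX.map_eq] at h
    exact h.comp_of_map hX.aemeasurable
  · have h := TruncNormal.variance_sq_law_le hlam hρ n
    have hm : Measurable fun x : Fin ν → ℝ => x n ^ 2 := by fun_prop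
    rw [← hX.map_eq, variance_map hm.aemeasurable hX.aemeasurable,
      integral_map hX.aemeasurable hm.aestronglyMeasurable] at h
    exact h
  · refine antitoneOn_of_deriv_nonpos (convex_Ioi 0) (fun t ht => ?_) (fun t ht => ?_)
      fun t ht => ?_
    · obtain ⟨d, -, h⟩ := hd t ht
      exact h.continuousAt.continuousWithinAt
    · rw [interior_Ioi] at ht
      obtain ⟨d, -, h⟩ := hd t ht
      exact h.differentiableAt.differentiableWithinAt
    · rw [interior_Ioi] at ht
      obtain ⟨d, hd0, h⟩ := hd t ht
      rwa [h.deriv]
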